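/- Let $(Z,d)$ be a nonempty, complete, locally compact metric space, let $\mu$ be a locally finite Borel measure on $Z$ with dense support (every nonempty open set has positive measure), and let $Q\ge 1$. A path is a continuous map $\gamma:[0,1]\to Z$, and for $E,F\subseteq Z$ let $\Gamma(E,F)$ be the family of paths connecting $E$ and $F$. The $Q$-modulus of a path family $\Gamma$ is $$\operatorname{Mod}_Q(\Gamma)=\inf\int_Z\rho^Q\,d\mu\in[0,\infty],$$ where the infimum is over all Borel functions $\rho:Z\to[0,\infty]$ with $\int_\gamma\rho\,ds\ge 1$ for every rectifiable $\gamma\in\Gamma$ (integration with respect to arclength; $\inf\emptyset=\infty$). Assume that for every $C>0$ there are constants $m=m(C)>0$ and $L=L(C)>0$ such that whenever $R>0$ and $B,B'\subseteq Z$ are open balls of radius $R$ with $\operatorname{dist}(B,B')\le CR$, one has $$\operatorname{Mod}_Q\bigl(\{\gamma\in\Gamma(B,B') : \operatorname{length}(\gamma)\le LR\}\bigr)>m.$$ Then $(Z,d,\mu)$ is $Q$-Loewner; that is, $Z$ is connected and there is a positive decreasing (that is, non-increasing) function $\Psi:(0,\infty)\to(0,\infty)$ such that $$\operatorname{Mod}_Q(\Gamma(E,F))\ge\Psi\left(\frac{\operatorname{dist}(E,F)}{\min\{\operatorname{diam}E,\operatorname{diam}F\}}\right)$$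 for all disjoint nondegenerate continua (compact connected sets with more than one point) $E,F\subseteq Z$. -/

import Mathlib

open MeasureTheory Set
open scoped ENNReal unitInterval

noncomputable section

namespace BallLoewner

/-- The distance `dist(E, F) = inf {d(x, y) : x ∈ E, y ∈ F}` between two nonempty sets. -/
def setDist {Z : Type*} [MetricSpace Z] (E F : Set Z) : ℝ :=
  sInf (Set.image2 dist E F)

/-- The relative distance `Δ(E, F)` of two bounded sets of positive diameter. -/
def relDist {Z : Type*} [MetricSpace Z] (E F : Set Z) : ℝ :=
  setDist E F / min (Metric.diam E) (Metric.diam F)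

/-- The length (total variation) of a path `γ : [0, 1] → Z`, possibly infinite. -/
def pathLength {Z : Type*} [MetricSpace Z] (γ : C(I, Z)) : ℝ≥0∞ :=
  eVariationOn γ univ

/-- A path is rectifiable if its length is finite. -/
def IsRectifiable {Z : Type*} [MetricSpace Z] (γ : C(I, Z)) : Prop :=
  pathLength γ ≠ ∞

/-- The line integral `∫_γ ρ ds` of a density along a rectifiable path of length `ℓ`: the integral
over `[0, ℓ]` of `ρ ∘ γₛ`, where `γₛ` is the arclength parametrization of `γ`. -/
def lineIntegral {Z : Type*} [MetricSpace Z] (ρ : Z → ℝ≥0∞) (γ : C(I, Z)) : ℝ≥0∞ :=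
  ∫⁻ t in Icc (0 : ℝ) (pathLength γ).toReal, ρ (naturalParameterization γ univ 0 t)

/-- A density `ρ` is admissible for a path family `Γ` if it is Borel and `∫_γ ρ ds ≥ 1` for each
rectifiable `γ ∈ Γ`. -/
def IsAdmissible {Z : Type*} [MetricSpace Z] [MeasurableSpace Z]
    (Γ : Set C(I, Z)) (ρ : Z → ℝ≥0∞) : Prop :=
  Measurable ρ ∧ ∀ γ ∈ Γ, IsRectifiable γ → 1 ≤ lineIntegral ρ γ

/-- The `Q`-modulus of a path family; it is `∞` if there is no admissible density. -/
def modulus {Z : Type*} [MetricSpace Z] [MeasurableSpace Z] (μ : Measure Z) (Q : ℝ)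
    (Γ : Set C(I, Z)) : ℝ≥0∞ :=
  ⨅ (ρ : Z → ℝ≥0∞) (_ : IsAdmissible Γ ρ), ∫⁻ z, ρ z ^ Q ∂μ

/-- The family `Γ(E, F)` of paths connecting `E` and `F`. -/
def connectingPaths {Z : Type*} [MetricSpace Z] (E F : Set Z) : Set C(I, Z) :=
  {γ | γ 0 ∈ E ∧ γ 1 ∈ F}

/-- A nondegenerate continuum: a compact connected set with more than one point. -/
def IsContinuum {Z : Type*} [MetricSpace Z] (E : Set Z) : Prop :=
  IsCompact E ∧ IsConnected E ∧ E.Nontrivial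

/-- `Q`-Loewner spaces: connected, with a lower bound for the modulus of the paths connecting two
disjoint continua by a positive decreasing function of their relative distance. -/
def IsLoewner {Z : Type*} [MetricSpace Z] [MeasurableSpace Z] (μ : Measure Z) (Q : ℝ) : Prop :=
  ConnectedSpace Z ∧
    ∃ Ψ : ℝ → ℝ, (∀ t, 0 < t → 0 < Ψ t) ∧ AntitoneOn Ψ (Ioi 0) ∧
      ∀ E F : Set Z, IsContinuum E → IsContinuum F → Disjoint E F →
        ENNReal.ofReal (Ψ (relDist E F)) ≤ modulus μ Q (connectingPaths E F)

end BallLoewner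

end

noncomputable section

namespace BallLoewner

open Filter Topology

variable {Z : Type*} [MetricSpace Z]

/-! Let `ρ` be admissible for the paths from `E` to `F`, with `∫ ρ ^ Q dμ` very small, and let `ν`
have density `ρ ^ Q`. A contradiction follows from a rectifiable path from `E` to `F` along which
`ρ` integrates to less than `1`. Testing the modulus hypothesis with a multiple of `ρ` cut off to a
ball gives a path between two balls of radius `R`, of length at most `L * R` and of cost at most `(ν
B / m) ^ (1 / Q)`, where `B` has radius `(L + 2) * R` (`exists_curve_of_lt_modulus`).

Such a path only reaches the vicinity of `E` and `F`. It is itself a connected set of controlled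
diameter, so each of the two gaps lies between connected sets and can be treated in the same way at
a scale smaller by `κ`. Generation `n` has `2 ^ n` gaps, so the cost per gap must decay faster than
`2 ^ (-n)`. The freedom to choose the next balls provides this: a connected set of diameter
comparable to `r` carries the centres of `N` disjoint balls, and one of them has at most `1 / N` of
the mass (`exists_point_measure_ball_le`). With `N ≥ 4 ^ Q` the cost bound drops by a factor `4` per
generation. As `B` is larger than the chosen ball, a `Gap` records mass bounds at all larger scales
too; this loses only a fixed factor `N ^ p` (`Gap.exists_children`).

The pieces are concatenated to a Lipschitz curve (`GapSystem.bridge`). Times outside all pieces form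
a null set, so its cost is at most a geometric sum (`Gap.exists_bridge`). One initial path and two
bridges join `E` to `F`. -/

/-! ### Arclength and line integrals -/

/-- A path of finite length has a continuous arclength function. -/
lemma continuous_variationOnFromTo {γ : C(I, Z)} (hγ : IsRectifiable γ) :
    Continuous (variationOnFromTo γ univ 0) := by
  have hloc : LocallyBoundedVariationOn γ univ :=
    BoundedVariationOn.locallyBoundedVariationOn hγ
  rw [continuous_iff_continuousAt]
  intro b
  rw [continuousAt_iff_continuous_left'_right']
  -- The one-sided jumps of the arclength function are those of `γ`, hence zero.
  have hl := variationOnFromTo.tendsto_left (f := γ) (l := γ b) (mem_univ (0 : I)) (mem_univ b) hloc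
    (γ.continuous.continuousAt.mono_left nhdsWithin_le_nhds)
  have hr := variationOnFromTo.tendsto_right (f := γ) (l := γ b) (mem_univ (0 : I)) (mem_univ b)
    hloc (γ.continuous.continuousAt.mono_left nhdsWithin_le_nhds)
  simp only [univ_inter, dist_self, sub_zero, add_zero] at hl hr
  exact ⟨hl, hr⟩

lemma variationOnFromTo_zero_one (γ : C(I, Z)) :
    variationOnFromTo γ univ 0 1 = (pathLength γ).toReal := by
  rw [variationOnFromTo.eq_of_le _ _ zero_le_one, pathLength]
  congr 2
  ext t
  simp [unitInterval.le_one']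

lemma image_variationOnFromTo {γ : C(I, Z)} (hγ : IsRectifiable γ) :
    variationOnFromTo γ univ 0 '' univ = Icc 0 (pathLength γ).toReal := by
  have hloc : LocallyBoundedVariationOn γ univ :=
    BoundedVariationOn.locallyBoundedVariationOn hγ
  have hmono := variationOnFromTo.monotoneOn hloc (mem_univ (0 : I))
  apply Subset.antisymm
  · rintro _ ⟨t, -, rfl⟩
    refine ⟨variationOnFromTo.nonneg_of_le _ _ unitInterval.nonneg', ?_⟩
    rw [← variationOnFromTo_zero_one]
    exact hmono (mem_univ _) (mem_univ _) unitInterval.le_one'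
  · have h := intermediate_value_univ (0 : I) 1 (continuous_variationOnFromTo hγ)
    rw [variationOnFromTo.self, variationOnFromTo_zero_one] at h
    rwa [image_univ]

lemma naturalParameterization_variationOnFromTo {γ : C(I, Z)} (hγ : IsRectifiable γ) (t : I) :
    naturalParameterization γ univ 0 (variationOnFromTo γ univ 0 t) = γ t :=
  edist_eq_zero.mp (edist_naturalParameterization_eq_zero
    (BoundedVariationOn.locallyBoundedVariationOn hγ) (mem_univ _) (mem_univ _))

/-- The arclength parametrization of a rectifiable path, extended to the real line by constants. -/
lemma exists_lipschitz_arclength {γ : C(I, Z)} (hγ : IsRectifiable γ) :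
    ∃ f : ℝ → Z, LipschitzWith 1 f ∧ f 0 = γ 0 ∧ f (pathLength γ).toReal = γ 1 ∧
      EqOn f (naturalParameterization γ univ 0) (Icc 0 (pathLength γ).toReal) := by
  have hloc : LocallyBoundedVariationOn γ univ :=
    BoundedVariationOn.locallyBoundedVariationOn hγ
  set ℓ := (pathLength γ).toReal with hℓ
  have h0 : (0 : ℝ) ≤ ℓ := ENNReal.toReal_nonneg
  have hspeed := has_unit_speed_naturalParameterization γ hloc (mem_univ (0 : I))
  rw [image_variationOnFromTo hγ, ← hℓ] at hspeed
  have hlip : LipschitzOnWith 1 (naturalParameterization γ univ 0) (Icc 0 ℓ) := by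
    refine LipschitzOnWith.of_dist_le_mul fun u hu v hv => ?_
    wlog huv : u ≤ v generalizing u v
    · rw [dist_comm, dist_comm u]
      exact this v hv u hu (le_of_not_ge huv)
    have h1 := eVariationOn.edist_le (naturalParameterization γ univ 0)
      (s := Icc 0 ℓ ∩ Icc u v) (x := u) (y := v) ⟨hu, left_mem_Icc.2 huv⟩
      ⟨hv, right_mem_Icc.2 huv⟩
    rw [hspeed hu hv, edist_dist, ENNReal.ofReal_le_ofReal_iff
      (mul_nonneg (by simp) (sub_nonneg.2 huv))] at h1
    rwa [dist_comm u v, Real.dist_eq, abs_of_nonneg (sub_nonneg.2 huv)]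
  have heq : EqOn (fun t => naturalParameterization γ univ 0 (projIcc 0 ℓ h0 t))
      (naturalParameterization γ univ 0) (Icc 0 ℓ) := fun t ht => by
    simp only [projIcc_of_mem h0 ht]
  refine ⟨fun t => naturalParameterization γ univ 0 (projIcc 0 ℓ h0 t), ?_, ?_, ?_, heq⟩
  · have h1 := hlip.to_restrict.comp (LipschitzWith.projIcc h0)
    rw [one_mul] at h1
    exact h1
  · rw [heq (left_mem_Icc.2 h0), ← naturalParameterization_variationOnFromTo hγ,
      variationOnFromTo.self]
  · rw [heq (right_mem_Icc.2 h0), ← naturalParameterization_variationOnFromTo hγ 1,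
      variationOnFromTo_zero_one]

/-- A `1`-Lipschitz substitution does not decrease integrals over its image. -/
lemma setLIntegral_image_le_of_lipschitz {φ : ℝ → ℝ} (hφ : LipschitzWith 1 φ) (S : Set ℝ)
    (g : ℝ → ℝ≥0∞) :
    ∫⁻ u in φ '' S, g u ≤ ∫⁻ t in S, g (φ t) := by
  have hle : volume.restrict (φ '' S) ≤ (volume.restrict S).map φ := by
    refine Measure.le_iff.2 fun A hA => ?_
    rw [Measure.restrict_apply hA, Measure.map_apply hφ.continuous.measurable hA,
      Measure.restrict_apply (hφ.continuous.measurable hA)]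
    have himage : A ∩ φ '' S = φ '' (φ ⁻¹' A ∩ S) := by
      rw [image_preimage_inter]
    rw [himage]
    -- On the line, Lebesgue measure is one-dimensional Hausdorff measure, so no injectivity of `φ`
    -- is needed.
    have h1 := hφ.hausdorffMeasure_image_le (zero_le_one' ℝ) (φ ⁻¹' A ∩ S)
    simpa [hausdorffMeasure_real] using h1
  exact (lintegral_mono' hle le_rfl).trans (lintegral_map_le _ _)

/-- The path `[0, 1] → Z` obtained from a curve defined on `[0, T]`. -/
def rescaledPath {h : ℝ → Z} (hh : LipschitzWith 1 h) (T : ℝ) : C(I, Z) :=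
  ⟨fun t => h (T * t), by have := hh.continuous; fun_prop⟩

lemma eVariationOn_rescaledPath_le {h : ℝ → Z} (hh : LipschitzWith 1 h) {T : ℝ} (hT : 0 ≤ T)
    (a b : I) :
    eVariationOn (rescaledPath hh T) (univ ∩ Icc a b) ≤ ENNReal.ofReal (T * b - T * a) := by
  have h1 := (hh.lipschitzOnWith (s := univ)).comp_eVariationOn_le
    (f := h) (g := fun t : I => T * (t : ℝ)) (s := univ ∩ Icc a b) (fun _ _ => mem_univ _)
  have hmono : MonotoneOn (fun t : I => T * (t : ℝ)) univ :=
    fun s _ t _ hst => mul_le_mul_of_nonneg_left hst hT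
  have h2 := hmono.eVariationOn_eq (mem_univ a) (mem_univ b)
  simp only [ENNReal.coe_one, one_mul] at h1
  exact h1.trans h2.le

lemma isRectifiable_rescaledPath {h : ℝ → Z} (hh : LipschitzWith 1 h) {T : ℝ} (hT : 0 ≤ T) :
    IsRectifiable (rescaledPath hh T) := by
  have h1 := eVariationOn_rescaledPath_le hh hT 0 1
  have h2 : (univ : Set I) ∩ Icc 0 1 = univ := by
    ext t; simp [unitInterval.le_one']
  rw [h2] at h1
  exact ne_top_of_le_ne_top ENNReal.ofReal_ne_top h1

/-- The line integral along a path is at most the integral over any `1`-Lipschitz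
parametrization. -/
lemma lineIntegral_rescaledPath_le {h : ℝ → Z} (hh : LipschitzWith 1 h) {T : ℝ} (hT : 0 ≤ T)
    (ρ : Z → ℝ≥0∞) :
    lineIntegral ρ (rescaledPath hh T) ≤ ∫⁻ t in Icc 0 T, ρ (h t) := by
  set γ := rescaledPath hh T with hγdef
  have hγ : IsRectifiable γ := isRectifiable_rescaledPath hh hT
  have hloc : LocallyBoundedVariationOn γ univ :=
    BoundedVariationOn.locallyBoundedVariationOn hγ
  have hvar : ∀ a b : I, a ≤ b →
      variationOnFromTo γ univ 0 b - variationOnFromTo γ univ 0 a ≤ T * b - T * a := by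
    intro a b hab
    rw [variationOnFromTo.sub_right hloc (mem_univ _) (mem_univ _) (mem_univ _),
      variationOnFromTo.eq_of_le _ _ hab]
    exact ENNReal.toReal_le_of_le_ofReal
      (sub_nonneg.2 (mul_le_mul_of_nonneg_left hab hT)) (eVariationOn_rescaledPath_le hh hT a b)
  have hmono := variationOnFromTo.monotoneOn hloc (mem_univ (0 : I))
  rcases hT.eq_or_lt with rfl | hT0
  · have h0 : (pathLength γ).toReal = 0 := by
      have h1 := hvar 0 1 zero_le_one
      rw [variationOnFromTo_zero_one, variationOnFromTo.self] at h1
      refine le_antisymm (by simpa using h1) ENNReal.toReal_nonneg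
    simp [lineIntegral, h0]
  -- The arclength covered up to time `t`. By `hvar` it is `1`-Lipschitz, and it maps `[0, T]` onto
  -- the domain of the arclength parametrization.
  · set φ : ℝ → ℝ := fun t => variationOnFromTo γ univ 0 (projIcc 0 1 zero_le_one (t / T)) with hφ
    have hφlip : LipschitzWith 1 φ := by
      refine LipschitzWith.of_dist_le_mul fun u v => ?_
      wlog huv : u ≤ v generalizing u v
      · rw [dist_comm, dist_comm u]
        exact this v u (le_of_not_ge huv)
      have hp : projIcc (0 : ℝ) 1 zero_le_one (u / T) ≤ projIcc (0 : ℝ) 1 zero_le_one (v / T) :=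
        monotone_projIcc _ (div_le_div_of_nonneg_right huv hT)
      have h1 := hvar _ _ hp
      have h2 := (LipschitzWith.projIcc (zero_le_one' ℝ)).dist_le_mul (v / T) (u / T)
      rw [Subtype.dist_eq, Real.dist_eq, Real.dist_eq, ← sub_div, abs_div, abs_of_pos hT0,
        abs_of_nonneg (sub_nonneg.2 huv)] at h2
      have h3 := (le_abs_self _).trans h2
      rw [NNReal.coe_one, one_mul, le_div_iff₀ hT0] at h3
      have h4 := hmono (mem_univ _) (mem_univ _) hp
      rw [dist_comm, Real.dist_eq, dist_comm u v, Real.dist_eq, abs_of_nonneg (sub_nonneg.2 h4),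
        abs_of_nonneg (sub_nonneg.2 huv), NNReal.coe_one, one_mul]
      linarith
    have himage : φ '' Icc 0 T = Icc 0 (pathLength γ).toReal := by
      rw [← image_variationOnFromTo hγ]
      apply Subset.antisymm
      · rintro _ ⟨t, -, rfl⟩
        exact ⟨_, mem_univ _, rfl⟩
      · rintro _ ⟨t, -, rfl⟩
        refine ⟨T * t, ⟨mul_nonneg hT t.2.1, mul_le_of_le_one_right hT t.2.2⟩, ?_⟩
        simp only [hφ, mul_div_cancel_left₀ _ hT0.ne', projIcc_val]
    rw [lineIntegral, ← himage]
    refine (setLIntegral_image_le_of_lipschitz hφlip _ _).trans ?_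
    refine lintegral_mono_ae ((ae_restrict_iff' measurableSet_Icc).2 (.of_forall fun t ht => ?_))
    have hmem : t / T ∈ Icc (0 : ℝ) 1 := ⟨div_nonneg ht.1 hT, (div_le_one hT0).2 ht.2⟩
    simp only [hφ]
    rw [naturalParameterization_variationOnFromTo hγ, projIcc_of_mem _ hmem]
    simp only [hγdef, rescaledPath, ContinuousMap.coe_mk]
    rw [mul_div_cancel₀ _ hT0.ne']

/-! ### Concatenation of curves -/

/-- Curves that are `1`-Lipschitz up to an additive error. -/
def CoarseLipschitz (e : ℝ) (f : ℝ → Z) : Prop :=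
  ∀ u v, u ≤ v → dist (f u) (f v) ≤ v - u + e

lemma CoarseLipschitz.lipschitzWith {f : ℝ → Z} (hf : CoarseLipschitz 0 f) : LipschitzWith 1 f := by
  refine LipschitzWith.of_dist_le_mul fun u v => ?_
  rw [NNReal.coe_one, one_mul]
  rcases le_total u v with h | h
  · rw [dist_comm u v, Real.dist_eq, abs_of_nonneg (sub_nonneg.2 h)]
    simpa using hf u v h
  · rw [dist_comm (f u), Real.dist_eq, abs_of_nonneg (sub_nonneg.2 h)]
    simpa using hf v u h

lemma coarseLipschitz_of_lipschitzWith {f : ℝ → Z} (hf : LipschitzWith 1 f) :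
    CoarseLipschitz 0 f := fun u v h => by
  have h1 := hf.dist_le_mul u v
  rwa [NNReal.coe_one, one_mul, dist_comm u v, Real.dist_eq, abs_of_nonneg (sub_nonneg.2 h),
    ← add_zero (v - u)] at h1

/-- The curve `u` up to the time `t₀`, followed by the curve `v`. -/
def glue {X : Type*} (t₀ : ℝ) (u v : ℝ → X) (t : ℝ) : X :=
  if t ≤ t₀ then u t else v (t - t₀)

lemma glue_of_le {X : Type*} {t₀ t : ℝ} {u v : ℝ → X} (h : t ≤ t₀) : glue t₀ u v t = u t :=
  if_pos h

lemma glue_of_ge {X : Type*} {t₀ t : ℝ} {u v : ℝ → X} (huv : u t₀ = v 0) (h : t₀ ≤ t) :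
    glue t₀ u v t = v (t - t₀) := by
  rcases h.eq_or_lt with rfl | h
  · rw [glue_of_le le_rfl, sub_self, huv]
  · exact if_neg h.not_ge

lemma CoarseLipschitz.glue {e₁ e₂ t₀ : ℝ} {u v : ℝ → Z} (hu : CoarseLipschitz e₁ u)
    (hv : CoarseLipschitz e₂ v) (h₁ : 0 ≤ e₁) (h₂ : 0 ≤ e₂) (huv : u t₀ = v 0) :
    CoarseLipschitz (e₁ + e₂) (glue t₀ u v) := by
  intro s t hst
  rcases le_total t t₀ with ht | ht
  · rw [glue_of_le ht, glue_of_le (hst.trans ht)]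
    linarith [hu s t hst]
  · rw [glue_of_ge huv ht]
    rcases le_total s t₀ with hs | hs
    · rw [glue_of_le hs]
      have h3 := hu s t₀ hs
      have h4 := hv 0 (t - t₀) (sub_nonneg.2 ht)
      have h5 := dist_triangle (u s) (u t₀) (v (t - t₀))
      rw [huv] at h5 h3
      linarith
    · rw [glue_of_ge huv hs]
      linarith [hv (s - t₀) (t - t₀) (by linarith)]

lemma setLIntegral_glue_le {X : Type*} (φ : X → ℝ≥0∞) {a b : ℝ} {u v : ℝ → X} (huv : u a = v 0) :
    ∫⁻ t in Icc 0 (a + b), φ (glue a u v t) ≤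
      (∫⁻ t in Icc 0 a, φ (u t)) + ∫⁻ t in Icc 0 b, φ (v t) := by
  have hsub : Icc 0 (a + b) ⊆ Icc 0 a ∪ Icc a (a + b) := fun t ht => by
    rcases le_total t a with h | h
    · exact Or.inl ⟨ht.1, h⟩
    · exact Or.inr ⟨h, ht.2⟩
  refine (lintegral_mono_set hsub).trans ((lintegral_union_le _ _ _).trans ?_)
  refine add_le_add (le_of_eq ?_) (le_of_eq ?_)
  · refine setLIntegral_congr_fun measurableSet_Icc fun t ht => ?_
    simp only [glue_of_le ht.2]
  · have h1 : ∫⁻ t in Icc a (a + b), φ (glue a u v t) =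
        ∫⁻ t in Icc a (a + b), φ (v (t - a)) := by
      refine setLIntegral_congr_fun measurableSet_Icc fun t ht => ?_
      simp only [glue_of_ge huv ht.1]
    have h2 := (measurePreserving_sub_right (volume : Measure ℝ) a).setLIntegral_comp_preimage_emb
      (MeasurableEquiv.subRight a).measurableEmbedding (fun t => φ (v t)) (Icc 0 b)
    rw [h1, ← h2]
    congr 2
    ext t
    simp only [mem_preimage, mem_Icc, sub_nonneg, tsub_le_iff_left]

/-! ### Gap systems and their bridges -/

/-- A system of gaps between pairs of points. A gap is bridged by a curve that leaves two gaps of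
at most a quarter of its size. -/
structure GapSystem (Z G : Type*) [MetricSpace Z] where
  left : G → G
  right : G → G
  source : G → Z
  target : G → Z
  curve : G → ℝ → Z
  duration : G → ℝ
  size : G → ℝ
  source_left : ∀ g, source (left g) = source g
  target_right : ∀ g, target (right g) = target g
  lipschitz_curve : ∀ g, CoarseLipschitz 0 (curve g)
  curve_zero : ∀ g, curve g 0 = target (left g)
  curve_duration : ∀ g, curve g (duration g) = source (right g)
  duration_nonneg : ∀ g, 0 ≤ duration g
  duration_le : ∀ g, duration g ≤ size g
  size_left : ∀ g, size (left g) ≤ size g / 4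
  size_right : ∀ g, size (right g) ≤ size g / 4
  dist_le : ∀ g, dist (source g) (target g) ≤ size g

namespace GapSystem

variable {G : Type*} (S : GapSystem Z G)

lemma size_nonneg (g : G) : 0 ≤ S.size g := dist_nonneg.trans (S.dist_le g)

/-- The total duration of the curves in the first `n` generations below a gap. -/
def partialTime : ℕ → G → ℝ
  | 0, _ => 0
  | n + 1, g => partialTime n (S.left g) + S.duration g + partialTime n (S.right g)

lemma partialTime_nonneg (n : ℕ) (g : G) : 0 ≤ S.partialTime n g := by
  induction n generalizing g with
  | zero => exact le_rfl
  | succ n ih => exact add_nonneg (add_nonneg (ih _) (S.duration_nonneg g)) (ih _)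

lemma partialTime_le (n : ℕ) (g : G) : S.partialTime n g ≤ 2 * S.size g := by
  induction n generalizing g with
  | zero => exact mul_nonneg two_pos.le (S.size_nonneg g)
  | succ n ih =>
    have h1 := ih (S.left g)
    have h2 := ih (S.right g)
    simp only [partialTime]
    linarith [S.size_left g, S.size_right g, S.duration_le g]

lemma partialTime_le_succ (n : ℕ) (g : G) : S.partialTime n g ≤ S.partialTime (n + 1) g := by
  induction n generalizing g with
  | zero => exact S.partialTime_nonneg 1 g
  | succ n ih => exact add_le_add (add_le_add (ih _) le_rfl) (ih _)

/-- The total duration of all curves below a gap. -/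
def time (g : G) : ℝ := ⨆ n, S.partialTime n g

lemma tendsto_partialTime (g : G) :
    Tendsto (fun n => S.partialTime n g) atTop (𝓝 (S.time g)) :=
  tendsto_atTop_ciSup (monotone_nat_of_le_succ fun n => S.partialTime_le_succ n g)
    ⟨2 * S.size g, by rintro _ ⟨n, rfl⟩; exact S.partialTime_le n g⟩

lemma time_nonneg (g : G) : 0 ≤ S.time g :=
  ge_of_tendsto' (S.tendsto_partialTime g) fun n => S.partialTime_nonneg n g

lemma time_le (g : G) : S.time g ≤ 2 * S.size g :=
  le_of_tendsto' (S.tendsto_partialTime g) fun n => S.partialTime_le n g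

lemma time_eq (g : G) : S.time g = S.time (S.left g) + (S.duration g + S.time (S.right g)) := by
  rw [← add_assoc]
  refine tendsto_nhds_unique ((S.tendsto_partialTime g).comp (tendsto_add_atTop_nat 1)) ?_
  exact ((S.tendsto_partialTime (S.left g)).add tendsto_const_nhds).add
    (S.tendsto_partialTime (S.right g))

lemma dist_le_partialTime_add (n : ℕ) (g : G) :
    dist (S.source g) (S.target g) ≤ S.partialTime n g + S.size g / 2 ^ n := by
  induction n generalizing g with
  | zero => simpa [partialTime] using S.dist_le g
  | succ n ih =>
    have h1 := ih (S.left g)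
    have h2 := ih (S.right g)
    have h3 := S.lipschitz_curve g 0 (S.duration g) (S.duration_nonneg g)
    rw [S.curve_zero, S.curve_duration] at h3
    rw [S.source_left] at h1
    rw [S.target_right] at h2
    have h4 := dist_triangle4 (S.source g) (S.target (S.left g)) (S.source (S.right g)) (S.target g)
    have h5 : S.size (S.left g) / 2 ^ n + S.size (S.right g) / 2 ^ n ≤
        S.size g / 2 ^ (n + 1) := by
      rw [← add_div, pow_succ', ← div_div]
      gcongr
      linarith [S.size_left g, S.size_right g]
    simp only [partialTime]
    linarith

/-- The gaps left after `n` generations have total size at most `S.size g / 2 ^ n`, which tends to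
zero. In particular, a gap of time zero is already closed. -/
lemma dist_le_time (g : G) : dist (S.source g) (S.target g) ≤ S.time g := by
  have h1 : Tendsto (fun n : ℕ => S.partialTime n g + S.size g / 2 ^ n) atTop
      (𝓝 (S.time g + 0)) :=
    (S.tendsto_partialTime g).add (tendsto_const_nhds.div_atTop
      (tendsto_pow_atTop_atTop_of_one_lt one_lt_two))
  rw [add_zero] at h1
  exact ge_of_tendsto' h1 fun n => S.dist_le_partialTime_add n g

/-- The concatenation of the curves in the first `n` generations below a gap, which jumps over the
remaining gaps. -/
def approx : ℕ → G → ℝ → Z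
  | 0, g => fun t => if t ≤ 0 then S.source g else S.target g
  | n + 1, g => glue (S.time (S.left g)) (approx n (S.left g))
      (glue (S.duration g) (S.curve g) (approx n (S.right g)))

lemma approx_of_nonpos (n : ℕ) (g : G) {t : ℝ} (ht : t ≤ 0) : S.approx n g t = S.source g := by
  induction n generalizing g with
  | zero => exact if_pos ht
  | succ n ih =>
    rw [approx, glue_of_le (ht.trans (S.time_nonneg _)), ih, S.source_left]

lemma curve_duration_eq_approx (n : ℕ) (g : G) :
    S.curve g (S.duration g) = S.approx n (S.right g) 0 := by
  rw [S.approx_of_nonpos n _ le_rfl, S.curve_duration]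

lemma approx_of_ge (n : ℕ) (g : G) {t : ℝ} (ht : S.time g ≤ t) :
    S.approx n g t = S.target g := by
  induction n generalizing g t with
  | zero =>
    by_cases h : t ≤ 0
    · have h0 : dist (S.source g) (S.target g) ≤ 0 := (S.dist_le_time g).trans (ht.trans h)
      simp only [approx, if_pos h]
      exact dist_le_zero.1 h0
    · exact if_neg h
  | succ n ih =>
    rw [S.time_eq] at ht
    have h1 := S.time_nonneg (S.left g)
    have h2 := S.time_nonneg (S.right g)
    have h3 := S.duration_nonneg g
    rw [approx, glue_of_ge _ (by linarith), glue_of_ge (S.curve_duration_eq_approx n g)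
      (by linarith), ih _ (by linarith), S.target_right]
    rw [glue_of_le h3, ih _ le_rfl, S.curve_zero]

lemma approx_left_eq (n : ℕ) (g : G) :
    S.approx n (S.left g) (S.time (S.left g)) =
      glue (S.duration g) (S.curve g) (S.approx n (S.right g)) 0 := by
  rw [S.approx_of_ge n _ le_rfl, glue_of_le (S.duration_nonneg g), S.curve_zero]

/-- The error is the sum of the remaining jumps: at most `2 ^ n` of them, each at most `S.size g / 4
^ n`. It vanishes in the limit. -/
lemma coarseLipschitz_approx (n : ℕ) (g : G) :
    CoarseLipschitz (S.size g / 2 ^ n) (S.approx n g) := by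
  induction n generalizing g with
  | zero =>
    intro u v huv
    have h0 := S.size_nonneg g
    have h1 := S.dist_le g
    have h2 : dist (S.approx 0 g u) (S.approx 0 g v) ≤ S.size g := by
      simp only [approx]
      split_ifs
      · simpa using h0
      · exact h1
      · rwa [dist_comm]
      · simpa using h0
    simp only [pow_zero, div_one]
    linarith
  | succ n ih =>
    have hl : 0 ≤ S.size (S.left g) / 2 ^ n := div_nonneg (S.size_nonneg _) (by positivity)
    have hr : 0 ≤ S.size (S.right g) / 2 ^ n := div_nonneg (S.size_nonneg _) (by positivity)
    have h1 := (ih (S.left g)).glue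
      ((S.lipschitz_curve g).glue (ih (S.right g)) le_rfl hr (S.curve_duration_eq_approx n g))
      hl (by linarith) (S.approx_left_eq n g)
    have h5 : S.size (S.left g) / 2 ^ n + (0 + S.size (S.right g) / 2 ^ n) ≤
        S.size g / 2 ^ (n + 1) := by
      rw [zero_add, ← add_div, pow_succ', ← div_div]
      gcongr
      linarith [S.size_left g, S.size_right g]
    intro u v huv
    exact (h1 u v huv).trans (by linarith)

/-- Passing to the next generation changes the curve only inside the time interval of one gap of
generation `n`. -/
lemma dist_approx_succ_le (n : ℕ) (g : G) (t : ℝ) :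
    dist (S.approx n g t) (S.approx (n + 1) g t) ≤ 4 * S.size g * (1 / 4) ^ n := by
  induction n generalizing g t with
  | zero =>
    have h0 := S.size_nonneg g
    rw [pow_zero, mul_one]
    rcases le_total t 0 with ht | ht
    · rw [S.approx_of_nonpos _ _ ht, S.approx_of_nonpos _ _ ht, dist_self]
      positivity
    rcases le_total (S.time g) t with ht' | ht'
    · rw [S.approx_of_ge _ _ ht', S.approx_of_ge _ _ ht', dist_self]
      positivity
    have h1 := S.coarseLipschitz_approx 1 g 0 t ht
    have h2 : dist (S.approx 0 g t) (S.source g) ≤ S.size g := by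
      simp only [approx]
      split_ifs
      · simpa using h0
      · rw [dist_comm]
        exact S.dist_le g
    rw [S.approx_of_nonpos 1 g le_rfl] at h1
    have h3 := dist_triangle (S.approx 0 g t) (S.source g) (S.approx 1 g t)
    have h4 := S.time_le g
    simp only [zero_add]
    linarith
  | succ n ih =>
    have hp : (0 : ℝ) ≤ (1 / 4) ^ n := by positivity
    have hle : ∀ g', S.size g' ≤ S.size g / 4 →
        4 * S.size g' * (1 / 4) ^ n ≤ 4 * S.size g * (1 / 4) ^ (n + 1) := by
      intro g' hg'
      rw [pow_succ']
      nlinarith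
    rw [approx, approx]
    by_cases h1 : t ≤ S.time (S.left g)
    · rw [glue_of_le h1, glue_of_le h1]
      exact (ih _ _).trans (hle _ (S.size_left g))
    · simp only [glue, if_neg h1]
      split_ifs
      · rw [dist_self]
        have := S.size_nonneg g
        positivity
      · exact (ih _ _).trans (hle _ (S.size_right g))

section Limit

variable [CompleteSpace Z]

lemma exists_tendsto_approx (g : G) (t : ℝ) :
    ∃ z, Tendsto (fun n => S.approx n g t) atTop (𝓝 z) :=
  cauchySeq_tendsto_of_complete (cauchySeq_of_le_geometric (1 / 4) (4 * S.size g) (by norm_num)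
    fun n => S.dist_approx_succ_le n g t)

/-- The curve that bridges a gap completely. -/
def bridge (g : G) (t : ℝ) : Z := (S.exists_tendsto_approx g t).choose

lemma tendsto_approx (g : G) (t : ℝ) :
    Tendsto (fun n => S.approx n g t) atTop (𝓝 (S.bridge g t)) :=
  (S.exists_tendsto_approx g t).choose_spec

lemma bridge_zero (g : G) : S.bridge g 0 = S.source g := by
  refine tendsto_nhds_unique (S.tendsto_approx g 0) ?_
  simp only [S.approx_of_nonpos _ _ le_rfl, tendsto_const_nhds]

lemma bridge_time (g : G) : S.bridge g (S.time g) = S.target g := by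
  refine tendsto_nhds_unique (S.tendsto_approx g _) ?_
  simp only [S.approx_of_ge _ _ le_rfl, tendsto_const_nhds]

lemma lipschitz_bridge (g : G) : CoarseLipschitz 0 (S.bridge g) := by
  intro u v huv
  have h1 : Tendsto (fun n : ℕ => v - u + S.size g / 2 ^ n) atTop (𝓝 (v - u + 0)) :=
    tendsto_const_nhds.add (tendsto_const_nhds.div_atTop
      (tendsto_pow_atTop_atTop_of_one_lt one_lt_two))
  exact le_of_tendsto_of_tendsto' ((S.tendsto_approx g u).dist (S.tendsto_approx g v)) h1
    fun n => S.coarseLipschitz_approx n g u v huv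

lemma bridge_eq (g : G) : S.bridge g = glue (S.time (S.left g)) (S.bridge (S.left g))
    (glue (S.duration g) (S.curve g) (S.bridge (S.right g))) := by
  ext t
  refine tendsto_nhds_unique ((S.tendsto_approx g t).comp (tendsto_add_atTop_nat 1)) ?_
  simp only [Function.comp_def, approx, glue]
  split_ifs
  · exact S.tendsto_approx _ _
  · exact tendsto_const_nhds
  · exact S.tendsto_approx _ _

/-- Unfolding the bridge `n` times leaves gaps of total time at most `2 * S.size g / 2 ^ n`, where
`φ ≤ K` is used. The costs `c` sum to at most `2 * c g`, as two children cost at most half their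
parent. -/
lemma setLIntegral_bridge_le_of_bounded {φ : Z → ℝ≥0∞} {K : ℕ} (hK : ∀ z, φ z ≤ K) {c : G → ℝ}
    (hc₀ : ∀ g, 0 ≤ c g)
    (hc : ∀ g, ∫⁻ t in Icc 0 (S.duration g), φ (S.curve g t) ≤ ENNReal.ofReal (c g))
    (hl : ∀ g, c (S.left g) ≤ c g / 4) (hr : ∀ g, c (S.right g) ≤ c g / 4) (n : ℕ) (g : G) :
    ∫⁻ t in Icc 0 (S.time g), φ (S.bridge g t) ≤
      ENNReal.ofReal (2 * c g + K * (2 * S.size g) / 2 ^ n) := by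
  induction n generalizing g with
  | zero =>
    calc ∫⁻ t in Icc 0 (S.time g), φ (S.bridge g t)
        ≤ ∫⁻ _ in Icc 0 (S.time g), (K : ℝ≥0∞) := lintegral_mono fun t => hK _
      _ = ENNReal.ofReal (K * S.time g) := by
          rw [setLIntegral_const, Real.volume_Icc, sub_zero, ENNReal.ofReal_mul (by positivity),
            ENNReal.ofReal_natCast]
      _ ≤ _ := by
          refine ENNReal.ofReal_le_ofReal ?_
          have := S.time_le g
          have h2 : (K : ℝ) * S.time g ≤ K * (2 * S.size g) := by gcongr
          have := hc₀ g
          rw [pow_zero, div_one]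
          linarith
  | succ n ih =>
    have e1 : S.curve g (S.duration g) = S.bridge (S.right g) 0 := by
      rw [S.bridge_zero, S.curve_duration]
    have e2 : S.bridge (S.left g) (S.time (S.left g)) =
        glue (S.duration g) (S.curve g) (S.bridge (S.right g)) 0 := by
      rw [S.bridge_time, glue_of_le (S.duration_nonneg g), S.curve_zero]
    have nn : ∀ g, 0 ≤ 2 * c g + K * (2 * S.size g) / 2 ^ n := fun g => by
      have := hc₀ g
      have := S.size_nonneg g
      positivity
    rw [S.bridge_eq, S.time_eq]
    refine (setLIntegral_glue_le φ e2).trans ((add_le_add (ih _) ((setLIntegral_glue_le φ e1).trans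
      (add_le_add (hc g) (ih _)))).trans ?_)
    rw [← ENNReal.ofReal_add (hc₀ g) (nn _), ← ENNReal.ofReal_add (nn _) (add_nonneg (hc₀ g) (nn _))]
    refine ENNReal.ofReal_le_ofReal ?_
    have h5 : K * (2 * S.size (S.left g)) / 2 ^ n + K * (2 * S.size (S.right g)) / 2 ^ n ≤
        K * (2 * S.size g) / 2 ^ (n + 1) := by
      rw [← add_div, pow_succ', ← div_div]
      have hK : (0 : ℝ) ≤ K := K.cast_nonneg
      refine div_le_div_of_nonneg_right ?_ (by positivity)
      nlinarith [S.size_left g, S.size_right g]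
    linarith [hl g, hr g]

/-- The cost of the bridge is the sum of the costs of the curves it is built from. -/
lemma setLIntegral_bridge_le [MeasurableSpace Z] [BorelSpace Z] {ρ : Z → ℝ≥0∞} (hρ : Measurable ρ)
    {c : G → ℝ} (hc₀ : ∀ g, 0 ≤ c g)
    (hc : ∀ g, ∫⁻ t in Icc 0 (S.duration g), ρ (S.curve g t) ≤ ENNReal.ofReal (c g))
    (hl : ∀ g, c (S.left g) ≤ c g / 4) (hr : ∀ g, c (S.right g) ≤ c g / 4) (g : G) :
    ∫⁻ t in Icc 0 (S.time g), ρ (S.bridge g t) ≤ ENNReal.ofReal (2 * c g) := by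
  -- Truncation at `K` makes the contribution of the unfilled times vanish; monotone convergence
  -- then removes it.
  have hb : ∀ K : ℕ, ∫⁻ t in Icc 0 (S.time g), min (ρ (S.bridge g t)) K ≤
      ENNReal.ofReal (2 * c g) := by
    intro K
    have h1 : Tendsto (fun n : ℕ => 2 * c g + K * (2 * S.size g) / 2 ^ n) atTop
        (𝓝 (2 * c g + 0)) :=
      tendsto_const_nhds.add (tendsto_const_nhds.div_atTop
        (tendsto_pow_atTop_atTop_of_one_lt one_lt_two))
    rw [add_zero] at h1
    exact ge_of_tendsto' (ENNReal.tendsto_ofReal h1) fun n =>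
      S.setLIntegral_bridge_le_of_bounded (φ := fun z => min (ρ z) K) (fun z => min_le_right _ _)
        hc₀ (fun g => (lintegral_mono fun t => min_le_left _ _).trans (hc g)) hl hr n g
  have hsup : ∀ t, ρ (S.bridge g t) = ⨆ K : ℕ, min (ρ (S.bridge g t)) K := fun t => by
    rw [← inf_iSup_eq, ENNReal.iSup_natCast, inf_top_eq]
  have hmeas : Measurable fun t => ρ (S.bridge g t) :=
    hρ.comp (S.lipschitz_bridge g).lipschitzWith.continuous.measurable
  rw [lintegral_congr hsup]
  rw [lintegral_iSup (fun K => hmeas.min measurable_const)]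
  · exact iSup_le hb
  · intro i j hij t
    exact min_le_min le_rfl (Nat.cast_le.2 hij)

end Limit

end GapSystem

/-! ### Cheap curves and points of small mass -/

/-- A lower bound for the modulus of a family of short paths yields a short curve along which a
given density has a small integral. -/
lemma exists_curve_of_lt_modulus [MeasurableSpace Z] [BorelSpace Z] {μ : Measure Z} {Q : ℝ}
    (hQ : 1 ≤ Q) {m L R M : ℝ} (hm : 0 < m) (hL : 0 < L) (hR : 0 < R) (hM : 0 < M) {a b : Z}
    (hmod : ENNReal.ofReal m < modulus μ Q
      {γ ∈ connectingPaths (Metric.ball a R) (Metric.ball b R) |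
        pathLength γ ≤ ENNReal.ofReal (L * R)})
    {ρ : Z → ℝ≥0∞} (hρ : Measurable ρ)
    (hmass : ∫⁻ z in Metric.ball a ((L + 2) * R), ρ z ^ Q ∂μ ≤ ENNReal.ofReal M) :
    ∃ (ℓ : ℝ) (f : ℝ → Z), 0 ≤ ℓ ∧ ℓ ≤ L * R ∧ CoarseLipschitz 0 f ∧ f 0 ∈ Metric.ball a R ∧
      f ℓ ∈ Metric.ball b R ∧
      ∫⁻ t in Icc 0 ℓ, ρ (f t) ≤ ENNReal.ofReal ((M / m) ^ (1 / Q)) := by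
  have hQ0 : 0 < Q := by linarith
  -- Chosen so that `k ^ Q * M = m`: the rescaled, cut-off density has too little energy to be
  -- admissible.
  set k : ℝ≥0∞ := ENNReal.ofReal ((m / M) ^ (1 / Q)) with hk
  have hkpos : 0 < (m / M) ^ (1 / Q) := Real.rpow_pos_of_pos (div_pos hm hM) _
  set U := Metric.ball a ((L + 2) * R) with hU
  set ρ' : Z → ℝ≥0∞ := fun z => k * U.indicator ρ z with hρ'
  have hρ'm : Measurable ρ' := (hρ.indicator Metric.isOpen_ball.measurableSet).const_mul _
  have hkQ : k ^ Q = ENNReal.ofReal (m / M) := by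
    rw [hk, ENNReal.ofReal_rpow_of_pos hkpos, ← Real.rpow_mul (div_pos hm hM).le,
      one_div_mul_cancel hQ0.ne', Real.rpow_one]
  have hint : ∫⁻ z, ρ' z ^ Q ∂μ ≤ ENNReal.ofReal m := by
    have h1 : ∀ z, ρ' z ^ Q = k ^ Q * U.indicator (fun z => ρ z ^ Q) z := by
      intro z
      rw [hρ', ENNReal.mul_rpow_of_nonneg _ _ hQ0.le]
      congr 1
      by_cases hz : z ∈ U
      · simp [hz]
      · simp [hz, hQ0]
    rw [lintegral_congr h1, lintegral_const_mul' _ _ (by rw [hkQ]; exact ENNReal.ofReal_ne_top),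
      lintegral_indicator Metric.isOpen_ball.measurableSet, hkQ]
    refine (mul_le_mul_right hmass _).trans ?_
    rw [← ENNReal.ofReal_mul (div_pos hm hM).le, div_mul_cancel₀ _ hM.ne']
  have hnot : ¬ IsAdmissible {γ ∈ connectingPaths (Metric.ball a R) (Metric.ball b R) |
      pathLength γ ≤ ENNReal.ofReal (L * R)} ρ' := fun h =>
    absurd ((iInf₂_le ρ' h).trans hint) (not_le.2 hmod)
  simp only [IsAdmissible, hρ'm, true_and, not_forall, not_le] at hnot
  obtain ⟨γ, ⟨⟨hγ0, hγ1⟩, hγL⟩, hγ, hlt⟩ := hnot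
  obtain ⟨f, hf, hf0, hf1, hfeq⟩ := exists_lipschitz_arclength hγ
  have hℓ : (pathLength γ).toReal ≤ L * R :=
    ENNReal.toReal_le_of_le_ofReal (mul_pos hL hR).le hγL
  refine ⟨(pathLength γ).toReal, f, ENNReal.toReal_nonneg, hℓ, coarseLipschitz_of_lipschitzWith hf,
    by rwa [hf0], by rwa [hf1], ?_⟩
  have hmem : ∀ t ∈ Icc 0 (pathLength γ).toReal, f t ∈ U := by
    intro t ht
    have h1 := coarseLipschitz_of_lipschitzWith hf 0 t ht.1
    rw [hf0] at h1
    have h2 := dist_triangle (f t) (γ 0) a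
    rw [dist_comm (f t) (γ 0)] at h2
    have h3 : dist (γ 0) a < R := hγ0
    rw [hU, Metric.mem_ball]
    linarith [ht.2]
  have hline : lineIntegral ρ' γ = k * ∫⁻ t in Icc 0 (pathLength γ).toReal, ρ (f t) := by
    rw [← lintegral_const_mul' _ _ ENNReal.ofReal_ne_top, lineIntegral]
    refine setLIntegral_congr_fun measurableSet_Icc fun t ht => ?_
    simp only [hρ', ← hfeq ht, indicator_of_mem (hmem t ht), hk]
  rw [hline] at hlt
  have hinv : k⁻¹ = ENNReal.ofReal ((M / m) ^ (1 / Q)) := by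
    rw [hk, ← ENNReal.ofReal_inv_of_pos hkpos, ← Real.inv_rpow (div_pos hm hM).le, inv_div]
  rw [← hinv, ENNReal.le_inv_iff_mul_le, mul_comm]
  exact hlt.le

/-- Among `N` disjoint balls in a set of mass at most `M`, one has mass at most `M / N`. -/
lemma exists_measure_ball_le [MeasurableSpace Z] [BorelSpace Z] (ν : Measure Z) {s : Finset ℕ}
    {N : ℕ} (hN : 0 < N) (hs : N ≤ s.card) {p : ℕ → Z} {δ M : ℝ} {U : Set Z}
    (hU : ν U ≤ ENNReal.ofReal M) (hsub : ∀ i ∈ s, Metric.ball (p i) δ ⊆ U)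
    (hdisj : (s : Set ℕ).PairwiseDisjoint fun i => Metric.ball (p i) δ) :
    ∃ i ∈ s, ν (Metric.ball (p i) δ) ≤ ENNReal.ofReal (M / N) := by
  by_contra! hcon
  have hne : s.Nonempty := Finset.card_pos.1 (hN.trans_le hs)
  have h1 := ENNReal.sum_lt_sum_of_nonempty hne hcon
  rw [← measure_biUnion_finset hdisj fun i _ => Metric.isOpen_ball.measurableSet,
    Finset.sum_const, nsmul_eq_mul] at h1
  have h2 : ν (⋃ i ∈ s, Metric.ball (p i) δ) ≤ ENNReal.ofReal M :=
    (measure_mono (iUnion₂_subset hsub)).trans hU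
  have h3 : ENNReal.ofReal M ≤ s.card * ENNReal.ofReal (M / N) := by
    have hN' : (0 : ℝ) < N := Nat.cast_pos.2 hN
    calc ENNReal.ofReal M = (N : ℝ≥0∞) * ENNReal.ofReal (M / N) := by
          rw [← ENNReal.ofReal_natCast, ← ENNReal.ofReal_mul hN'.le, mul_div_cancel₀ _ hN'.ne']
      _ ≤ _ := by gcongr
  exact absurd (h1.trans_le (h2.trans h3)) (lt_irrefl _)

lemma exists_dist_eq {A : Set Z} (hA : IsPreconnected A) {a z : Z} (ha : a ∈ A) (hz : z ∈ A)
    {s : ℝ} (hs : 0 ≤ s) (hsz : s ≤ dist z a) : ∃ w ∈ A, dist w a = s := by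
  have h1 := hA.intermediate_value (f := fun w => dist w a) ha hz (by fun_prop)
  exact h1 ⟨by simpa using hs, hsz⟩

/-- A connected set of diameter at least `r` contains a point with a small ball of small mass,
away from a given point `q`. -/
lemma exists_point_measure_ball_le [MeasurableSpace Z] [BorelSpace Z] (ν : Measure Z) {N : ℕ}
    (hN : 0 < N) {A U : Set Z} (hA : IsPreconnected A) {a z : Z} (ha : a ∈ A) (hz : z ∈ A)
    {r δ M : ℝ} (hδ : 0 < δ) (hNr : 2 * δ * N ≤ r) (hrz : r ≤ dist z a)
    (hU : ν U ≤ ENNReal.ofReal M) (hsub : Metric.ball a (r + δ) ⊆ U) (q : Z) :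
    ∃ w ∈ A, dist w a ≤ r ∧ δ ≤ dist w q ∧ ν (Metric.ball w δ) ≤ ENNReal.ofReal (M / N) := by
  have hex : ∀ i : ℕ, ∃ w, i ≤ N → w ∈ A ∧ dist w a = 2 * δ * i := by
    intro i
    by_cases hi : i ≤ N
    · have h1 : 2 * δ * i ≤ 2 * δ * N := by gcongr
      obtain ⟨w, hw, hwa⟩ := exists_dist_eq hA ha hz (s := 2 * δ * i) (by positivity)
        (h1.trans (hNr.trans hrz))
      exact ⟨w, fun _ => ⟨hw, hwa⟩⟩
    · exact ⟨a, fun h => absurd h hi⟩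
  choose p hp using hex
  have hsep : ∀ i j, i ≤ N → j ≤ N → i < j → 2 * δ ≤ dist (p i) (p j) := by
    intro i j hi hj hij
    have h1 := dist_triangle (p j) (p i) a
    rw [(hp i hi).2, (hp j hj).2, dist_comm] at h1
    have h2 : (i : ℝ) + 1 ≤ j := by exact_mod_cast hij
    nlinarith
  have hsep' : ∀ i j, i ≤ N → j ≤ N → i ≠ j → 2 * δ ≤ dist (p i) (p j) := by
    intro i j hi hj hij
    rcases hij.lt_or_gt with h | h
    · exact hsep i j hi hj h
    · rw [dist_comm]
      exact hsep j i hj hi h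
  set s := (Finset.range (N + 1)).filter fun i => δ ≤ dist (p i) q with hs
  have hmem : ∀ i ∈ s, i ≤ N := fun i hi =>
    Nat.lt_succ_iff.1 (Finset.mem_range.1 (Finset.mem_filter.1 hi).1)
  have hcard : N ≤ s.card := by
    have h1 : s.card + ((Finset.range (N + 1)).filter fun i => ¬ δ ≤ dist (p i) q).card =
        (Finset.range (N + 1)).card := Finset.card_filter_add_card_filter_not _
    -- The points are `2 * δ`-separated, so `q` spoils at most one of the `N + 1`.
    have h2 : ((Finset.range (N + 1)).filter fun i => ¬ δ ≤ dist (p i) q).card ≤ 1 := by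
      refine Finset.card_le_one.2 fun i hi j hj => ?_
      rw [Finset.mem_filter, Finset.mem_range, not_le] at hi hj
      by_contra hij
      have h3 := hsep' i j (Nat.lt_succ_iff.1 hi.1) (Nat.lt_succ_iff.1 hj.1) hij
      have h4 := dist_triangle_right (p i) (p j) q
      linarith [hi.2, hj.2]
    rw [Finset.card_range] at h1
    omega
  obtain ⟨i, hi, hνi⟩ := exists_measure_ball_le ν hN hcard (p := p) (δ := δ) hU
    (fun i hi => by
      refine Subset.trans (Metric.ball_subset_ball' ?_) hsub
      have h1 : 2 * δ * i ≤ 2 * δ * N := by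
        have := hmem i hi
        gcongr
      rw [(hp i (hmem i hi)).2]
      linarith)
    (fun i hi j hj hij => Metric.ball_disjoint_ball (by
      linarith [hsep' i j (hmem i hi) (hmem j hj) hij]))
  have h1 : 2 * δ * i ≤ 2 * δ * N := by
    have := hmem i hi
    gcongr
  exact ⟨p i, (hp i (hmem i hi)).1, by rw [(hp i (hmem i hi)).2]; linarith,
    (Finset.mem_filter.1 hi).2, hνi⟩

/-- The part of a curve between two of its points, in either direction. -/
lemma exists_subcurve {f : ℝ → Z} (hf : CoarseLipschitz 0 f) {ℓ s t : ℝ} (hs : s ∈ Icc 0 ℓ)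
    (ht : t ∈ Icc 0 ℓ) :
    ∃ (d : ℝ) (f' : ℝ → Z), 0 ≤ d ∧ d ≤ ℓ ∧ CoarseLipschitz 0 f' ∧ f' 0 = f s ∧ f' d = f t ∧
      ∀ φ : Z → ℝ≥0∞, ∫⁻ u in Icc 0 d, φ (f' u) ≤ ∫⁻ u in Icc 0 ℓ, φ (f u) := by
  rcases le_total s t with hst | hst
  · refine ⟨t - s, fun u => f (s + u), sub_nonneg.2 hst, by linarith [hs.1, ht.2],
      fun u v huv => ?_, by simp, by simp, fun φ => ?_⟩
    · linarith [hf (s + u) (s + v) (by linarith)]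
    · have h2 := (measurePreserving_add_left (volume : Measure ℝ)
        s).setLIntegral_comp_preimage_emb (MeasurableEquiv.addLeft s).measurableEmbedding
        (fun t => φ (f t)) (Icc 0 ℓ)
      rw [← h2]
      refine lintegral_mono_set fun u hu => ?_
      exact ⟨by linarith [hs.1, hu.1], by linarith [hu.2, ht.2]⟩
  · refine ⟨s - t, fun u => f (s - u), sub_nonneg.2 hst, by linarith [hs.2, ht.1],
      fun u v huv => ?_, by simp, by simp, fun φ => ?_⟩
    · rw [dist_comm]
      linarith [hf (s - v) (s - u) (by linarith)]
    · have h2 := (Measure.measurePreserving_sub_left (volume : Measure ℝ)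
        s).setLIntegral_comp_preimage_emb (MeasurableEquiv.subLeft s).measurableEmbedding
        (fun t => φ (f t)) (Icc 0 ℓ)
      rw [← h2]
      refine lintegral_mono_set fun u hu => ?_
      exact ⟨by linarith [ht.1, hu.2], by linarith [hu.1, hs.2]⟩

/-- Limits of orbits of a map whose steps decrease geometrically. -/
lemma exists_orbit_limit [CompleteSpace Z] {G : Type*} (F : G → G) (pt : G → Z) (r : G → ℝ)
    {κ : ℝ} (hκ : κ ≤ 1 / 2) (hr₀ : ∀ g, 0 ≤ r g) (hr : ∀ g, r (F g) = κ * r g)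
    (hpt : ∀ g, dist (pt g) (pt (F g)) ≤ r g) :
    ∃ x : G → Z, (∀ g, x (F g) = x g) ∧ (∀ g, dist (pt g) (x g) ≤ 2 * r g) ∧
      ∀ g, ∀ K : Set Z, IsClosed K → (∀ n, pt (F^[n] g) ∈ K) → x g ∈ K := by
  have hrn : ∀ n g, r (F^[n] g) = r g * κ ^ n := by
    intro n g
    induction n with
    | zero => simp
    | succ n ih => rw [Function.iterate_succ_apply', hr, ih, pow_succ]; ring
  have hstep : ∀ g n, dist (pt (F^[n] g)) (pt (F^[n + 1] g)) ≤ r g * κ ^ n := by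
    intro g n
    rw [← hrn, Function.iterate_succ_apply']
    exact hpt _
  have hκ1 : κ < 1 := by linarith
  choose x hx using fun g =>
    cauchySeq_tendsto_of_complete (cauchySeq_of_le_geometric κ (r g) hκ1 (hstep g))
  refine ⟨x, fun g => ?_, fun g => ?_, fun g K hK hmem => ?_⟩
  · refine tendsto_nhds_unique (hx (F g)) ?_
    exact (hx g).comp (tendsto_add_atTop_nat 1)
  · have h1 := dist_le_of_le_geometric_of_tendsto₀ κ (r g) hκ1 (hstep g) (hx g)
    refine h1.trans ?_
    rw [div_le_iff₀ (by linarith)]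
    nlinarith [hr₀ g]
  · exact hK.mem_of_tendsto (hx g) (.of_forall hmem)

/-! ### Filling gaps between connected sets -/

/-- A gap of scale `scale` between two connected sets, near a point where the measure `ν` decays
geometrically at larger scales. -/
structure Gap [MeasurableSpace Z] (ν : Measure Z) (N : ℕ) (κ : ℝ) where
  fst : Set Z
  snd : Set Z
  fstPt : Z
  sndPt : Z
  scale : ℝ
  mass : ℝ
  isClosed_fst : IsClosed fst
  isClosed_snd : IsClosed snd
  isPreconnected_fst : IsPreconnected fst
  isPreconnected_snd : IsPreconnected snd
  fstPt_mem : fstPt ∈ fst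
  sndPt_mem : sndPt ∈ snd
  scale_pos : 0 < scale
  mass_pos : 0 < mass
  exists_fst : ∃ z ∈ fst, scale ≤ dist z fstPt
  exists_snd : ∃ z ∈ snd, scale ≤ dist z sndPt
  dist_le : dist fstPt sndPt ≤ scale
  measure_le : ∀ j : ℕ, ν (Metric.ball fstPt (((κ ^ j)⁻¹ + 4) * scale)) ≤
    ENNReal.ofReal (N ^ j * mass)

/-- Balls of radius `R` with centres at distance at most `C * R` are joined by curves of length at
most `L * R` whose cost is controlled by the `ν`-mass of a comparable ball. -/
def HasCheapCurves [MeasurableSpace Z] (ν : Measure Z) (ρ : Z → ℝ≥0∞) (Q C m L : ℝ) : Prop :=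
  ∀ (a b : Z) (R M : ℝ), 0 < R → 0 < M → dist a b ≤ C * R →
    ν (Metric.ball a ((L + 2) * R)) ≤ ENNReal.ofReal M →
    ∃ (ℓ : ℝ) (f : ℝ → Z), 0 ≤ ℓ ∧ ℓ ≤ L * R ∧ CoarseLipschitz 0 f ∧ f 0 ∈ Metric.ball a R ∧
      f ℓ ∈ Metric.ball b R ∧ ∫⁻ t in Icc 0 ℓ, ρ (f t) ≤ ENNReal.ofReal ((M / m) ^ (1 / Q))

lemma isCompact_image_curve {f : ℝ → Z} (hf : CoarseLipschitz 0 f) (ℓ : ℝ) :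
    IsCompact (f '' Icc 0 ℓ) :=
  isCompact_Icc.image hf.lipschitzWith.continuous

lemma isPreconnected_image_curve {f : ℝ → Z} (hf : CoarseLipschitz 0 f) (ℓ : ℝ) :
    IsPreconnected (f '' Icc 0 ℓ) :=
  isPreconnected_Icc.image _ hf.lipschitzWith.continuous.continuousOn

/-- A gap can be bridged by a cheap curve up to two smaller gaps. -/
lemma Gap.exists_children [MeasurableSpace Z] [BorelSpace Z] {ν : Measure Z} {ρ : Z → ℝ≥0∞}
    {Q m L κ : ℝ} {N p : ℕ} (hN : 0 < N) (hκ : κ = 1 / (12 * N))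
    (hp : L + 2 ≤ (κ ^ p)⁻¹) (hcurve : HasCheapCurves ν ρ Q (3 / κ) m L) (g : Gap ν N κ) :
    ∃ (gl gr : Gap ν N κ) (ℓ : ℝ) (f : ℝ → Z), 0 ≤ ℓ ∧ ℓ ≤ L * (κ * g.scale) ∧
      CoarseLipschitz 0 f ∧
      ∫⁻ t in Icc 0 ℓ, ρ (f t) ≤ ENNReal.ofReal ((N ^ p * g.mass / m) ^ (1 / Q)) ∧
      gl.fst = g.fst ∧ gl.snd = f '' Icc 0 ℓ ∧ gr.fst = f '' Icc 0 ℓ ∧ gr.snd = g.snd ∧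
      gl.scale = κ * g.scale ∧ gr.scale = κ * g.scale ∧ gl.mass = g.mass / N ∧
      gr.mass = g.mass / N ∧ dist g.fstPt gl.fstPt ≤ g.scale ∧ dist g.sndPt gr.sndPt ≤ g.scale := by
  have hN' : (1 : ℝ) ≤ N := by exact_mod_cast hN
  have hκ0 : 0 < κ := by rw [hκ]; positivity
  have hκN : 12 * κ * N = 1 := by rw [hκ]; field_simp
  have hκ1 : κ ≤ 1 / 12 := by nlinarith
  have hr := g.scale_pos
  have hM := g.mass_pos
  set r := g.scale with hrdef
  set M := g.mass with hMdef
  set a := g.fstPt with hadef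
  set b := g.sndPt with hbdef
  have hab : dist a b ≤ r := g.dist_le
  obtain ⟨za, hzaA, hza⟩ := g.exists_fst
  obtain ⟨zb, hzbB, hzb⟩ := g.exists_snd
  have hU := g.measure_le 0
  rw [pow_zero, pow_zero, one_mul, inv_one] at hU
  have hδ : 0 < 6 * κ * r := by positivity
  have hNr : 2 * (6 * κ * r) * N ≤ r := by nlinarith
  obtain ⟨b', hb'B, hb'b, -, hνb'⟩ := exists_point_measure_ball_le ν hN g.isPreconnected_snd
    g.sndPt_mem hzbB hδ hNr hzb hU
    (Metric.ball_subset_ball' (by rw [dist_comm]; nlinarith)) b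
  -- Keeping `a'` at distance `6 * κ * r` from `b'` forces the connecting curve to have diameter at
  -- least `κ * r`, as its child gaps require.
  obtain ⟨a', ha'A, ha'a, ha'b', hνa'⟩ := exists_point_measure_ball_le ν hN g.isPreconnected_fst
    g.fstPt_mem hzaA hδ hNr hza hU (Metric.ball_subset_ball (by nlinarith)) b'
  rw [← hadef] at ha'a
  rw [← hbdef] at hb'b
  have hκr : 0 < κ * r := by positivity
  have hdist : dist a' b' ≤ 3 / κ * (κ * r) := by
    have h1 := dist_triangle4 a' a b b'
    rw [dist_comm b b'] at h1
    rw [div_mul_eq_mul_div, mul_div_assoc, mul_div_cancel_left₀ _ hκ0.ne']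
    linarith
  have hmass : ν (Metric.ball a' ((L + 2) * (κ * r))) ≤ ENNReal.ofReal (N ^ p * M) := by
    refine (measure_mono (Metric.ball_subset_ball' ?_)).trans (g.measure_le p)
    rw [← hadef, ← hrdef]
    have h1 : (L + 2) * (κ * r) ≤ (κ ^ p)⁻¹ * r := by
      refine mul_le_mul hp (by nlinarith) hκr.le (by positivity)
    linarith
  obtain ⟨ℓ, f, hℓ0, hℓ, hf, hf0, hf1, hcost⟩ := hcurve a' b' (κ * r) (N ^ p * M) hκr
    (by positivity) hdist hmass
  rw [Metric.mem_ball] at hf0 hf1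
  have hf01 : κ * r ≤ dist (f ℓ) (f 0) := by
    have h1 := dist_triangle4 a' (f 0) (f ℓ) b'
    rw [dist_comm a' (f 0), dist_comm (f 0) (f ℓ)] at h1
    linarith
  have h0mem : f 0 ∈ f '' Icc 0 ℓ := ⟨0, left_mem_Icc.2 hℓ0, rfl⟩
  have h1mem : f ℓ ∈ f '' Icc 0 ℓ := ⟨ℓ, right_mem_Icc.2 hℓ0, rfl⟩
  have hfar : ∀ {S : Set Z} {c c' z : Z}, c ∈ S → z ∈ S → r ≤ dist z c →
      ∃ z ∈ S, κ * r ≤ dist z c' := by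
    intro S c c' z hc hz hzc
    have h1 := dist_triangle_right z c c'
    by_contra! hcon
    have h2 := hcon z hz
    have h3 := hcon c hc
    nlinarith
  have hM' : 0 < M / N := by positivity
  -- For `j = 0` the bound is the choice of a light ball. For `j + 1` the ball lies in the parent's
  -- ball of index `j`; the slack `4` absorbs the shift of the centre.
  have hdecay : ∀ w : Z, ν (Metric.ball w (5 * κ * r)) ≤ ENNReal.ofReal (M / N) →
      dist w a ≤ (2 + κ) * r → ∀ j : ℕ, ν (Metric.ball w (((κ ^ j)⁻¹ + 4) * (κ * r))) ≤
        ENNReal.ofReal (N ^ j * (M / N)) := by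
    intro w hw hwa j
    cases j with
    | zero =>
      rw [pow_zero, pow_zero, one_mul, inv_one]
      convert hw using 3
      ring
    | succ j =>
      have h1 : (N : ℝ) ^ (j + 1) * (M / N) = N ^ j * M := by
        rw [pow_succ]
        field_simp
      rw [h1]
      refine (measure_mono (Metric.ball_subset_ball' ?_)).trans (g.measure_le j)
      rw [← hadef, ← hrdef]
      have h2 : (κ ^ (j + 1))⁻¹ * (κ * r) = (κ ^ j)⁻¹ * r := by
        rw [pow_succ]
        field_simp
      rw [add_mul, h2]
      nlinarith
  refine ⟨⟨g.fst, f '' Icc 0 ℓ, a', f 0, κ * r, M / N, g.isClosed_fst,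
      (isCompact_image_curve hf ℓ).isClosed, g.isPreconnected_fst, isPreconnected_image_curve hf ℓ,
      ha'A, h0mem, hκr, hM', hfar g.fstPt_mem hzaA hza, ⟨f ℓ, h1mem, hf01⟩,
      by rw [dist_comm]; exact hf0.le, ?_⟩,
    ⟨f '' Icc 0 ℓ, g.snd, f ℓ, b', κ * r, M / N, (isCompact_image_curve hf ℓ).isClosed,
      g.isClosed_snd, isPreconnected_image_curve hf ℓ, g.isPreconnected_snd,
      h1mem, hb'B, hκr, hM', ⟨f 0, h0mem, by rwa [dist_comm]⟩, hfar g.sndPt_mem hzbB hzb,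
      hf1.le, ?_⟩,
    ℓ, f, hℓ0, hℓ, hf, hcost, rfl, rfl, rfl, rfl, rfl, rfl, rfl, rfl,
    by rw [dist_comm]; exact ha'a, by rw [dist_comm]; exact hb'b⟩
  · refine hdecay a' ((measure_mono (Metric.ball_subset_ball ?_)).trans hνa') ?_
    · nlinarith
    · nlinarith
  -- The radius `6 * κ * r` of the light balls leaves room for the distance, below `κ * r`, from `f
  -- ℓ` to `b'`.
  · refine hdecay (f ℓ) ((measure_mono (Metric.ball_subset_ball' ?_)).trans hνb') ?_
    · nlinarith
    · have h1 := dist_triangle4 (f ℓ) b' b a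
      rw [dist_comm b a] at h1
      linarith

/-- The two sides of a gap are joined by a curve of cost controlled by the mass near the gap. -/
lemma Gap.exists_bridge [CompleteSpace Z] [MeasurableSpace Z] [BorelSpace Z] {ν : Measure Z}
    {ρ : Z → ℝ≥0∞} (hρ : Measurable ρ) {Q m L κ : ℝ} {N p : ℕ} (hQ : 1 ≤ Q) (hm : 0 < m)
    (hL : 0 < L) (hN : 0 < N) (hNQ : (4 : ℝ) ^ Q ≤ N) (hκ : κ = 1 / (12 * N))
    (hp : L + 2 ≤ (κ ^ p)⁻¹) (hcurve : HasCheapCurves ν ρ Q (3 / κ) m L) (g : Gap ν N κ) :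
    ∃ (T : ℝ) (h : ℝ → Z), 0 ≤ T ∧ CoarseLipschitz 0 h ∧ h 0 ∈ g.fst ∧ h T ∈ g.snd ∧
      ∫⁻ t in Icc 0 T, ρ (h t) ≤ ENNReal.ofReal (2 * (N ^ p * g.mass / m) ^ (1 / Q)) := by
  have hQ0 : 0 < Q := by linarith
  have hN' : (1 : ℝ) ≤ N := by exact_mod_cast hN
  have hκ0 : 0 < κ := by rw [hκ]; positivity
  have hκN : 12 * κ * N = 1 := by rw [hκ]; field_simp
  have hκ1 : κ ≤ 1 / 12 := by nlinarith
  choose l r ℓ f hℓ0 hℓ hf hcost hlfst hlsnd hrfst hrsnd hlscale hrscale hlmass hrmass hlpt hrpt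
    using fun g : Gap ν N κ => g.exists_children hN hκ hp hcurve
  -- The final endpoint on the first side is the limit along left children. These all have the same
  -- first set, so the limit lies in it and is shared by `g` and `l g`; right children do the same
  -- for `y`.
  obtain ⟨x, hxl, hxd, hxK⟩ := exists_orbit_limit l Gap.fstPt Gap.scale (by linarith)
    (fun g => g.scale_pos.le) hlscale hlpt
  obtain ⟨y, hyr, hyd, hyK⟩ := exists_orbit_limit r Gap.sndPt Gap.scale (by linarith)
    (fun g => g.scale_pos.le) hrscale hrpt
  have hx : ∀ g, x g ∈ g.fst := fun g => by
    refine hxK g _ g.isClosed_fst fun n => ?_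
    have h1 : (l^[n] g).fst = g.fst := by
      induction n with
      | zero => rfl
      | succ n ih => rw [Function.iterate_succ_apply', hlfst, ih]
    rw [← h1]
    exact (l^[n] g).fstPt_mem
  have hy : ∀ g, y g ∈ g.snd := fun g => by
    refine hyK g _ g.isClosed_snd fun n => ?_
    have h1 : (r^[n] g).snd = g.snd := by
      induction n with
      | zero => rfl
      | succ n ih => rw [Function.iterate_succ_apply', hrsnd, ih]
    rw [← h1]
    exact (r^[n] g).sndPt_mem
  have hyl : ∀ g, ∃ s ∈ Icc 0 (ℓ g), f g s = y (l g) := fun g => by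
    have := hy (l g)
    rwa [hlsnd] at this
  have hxr : ∀ g, ∃ s ∈ Icc 0 (ℓ g), f g s = x (r g) := fun g => by
    have := hx (r g)
    rwa [hrfst] at this
  choose s hs hsy using hyl
  choose t ht htx using hxr
  -- Only the part of `f g` between the landing points of the two child bridges is kept; these may
  -- occur in either order.
  choose d f' hd0 hd hf' hf'0 hf'1 hf'cost using fun g => exists_subcurve (hf g) (hs g) (ht g)
  let S : GapSystem Z (Gap ν N κ) :=
    { left := l
      right := r
      source := x
      target := y
      curve := f'
      duration := d
      -- The limits move each base point by at most `2 * g.scale` and the base points are `g.scale`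
      -- apart, which gives `5`; `L` covers the length of the curve.
      size := fun g => (5 + L) * g.scale
      source_left := hxl
      target_right := hyr
      lipschitz_curve := hf'
      curve_zero := fun g => by rw [hf'0, hsy]
      curve_duration := fun g => by rw [hf'1, htx]
      duration_nonneg := hd0
      duration_le := fun g => by
        have h1 := hd g
        have h2 := hℓ g
        have h3 := g.scale_pos
        have h4 : L * (κ * g.scale) ≤ L * g.scale := by gcongr; nlinarith
        linarith
      size_left := fun g => by
        rw [hlscale]
        have h3 := mul_pos (by linarith : 0 < 5 + L) g.scale_pos
        nlinarith
      size_right := fun g => by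
        rw [hrscale]
        have h3 := mul_pos (by linarith : 0 < 5 + L) g.scale_pos
        nlinarith
      dist_le := fun g => by
        have h1 := dist_triangle4 (x g) g.fstPt g.sndPt (y g)
        rw [dist_comm (x g) g.fstPt] at h1
        have h2 := mul_pos hL g.scale_pos
        linarith [hxd g, hyd g, g.dist_le] }
  have hpos : ∀ g : Gap ν N κ, 0 < N ^ p * g.mass / m := fun g => by
    have := g.mass_pos
    positivity
  have hroot : (1 / (N : ℝ)) ^ (1 / Q) ≤ 1 / 4 := by
    have h1 : (1 / (N : ℝ)) ≤ (1 / 4) ^ Q := by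
      rw [Real.div_rpow zero_le_one (by norm_num), Real.one_rpow]
      exact one_div_le_one_div_of_le (by positivity) hNQ
    calc (1 / (N : ℝ)) ^ (1 / Q) ≤ ((1 / 4 : ℝ) ^ Q) ^ (1 / Q) :=
          Real.rpow_le_rpow (by positivity) h1 (by positivity)
      _ = 1 / 4 := by
          rw [← Real.rpow_mul (by norm_num), mul_one_div_cancel hQ0.ne', Real.rpow_one]
  have hdecay : ∀ g g' : Gap ν N κ, g'.mass = g.mass / N →
      (N ^ p * g'.mass / m) ^ (1 / Q) ≤ (N ^ p * g.mass / m) ^ (1 / Q) / 4 := by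
    intro g g' hg
    have h1 : N ^ p * g'.mass / m = N ^ p * g.mass / m * (1 / N) := by
      rw [hg]
      field_simp
    rw [h1, Real.mul_rpow (hpos g).le (by positivity)]
    have h2 : 0 ≤ (N ^ p * g.mass / m) ^ (1 / Q) := Real.rpow_nonneg (hpos g).le _
    nlinarith
  refine ⟨S.time g, S.bridge g, S.time_nonneg g, S.lipschitz_bridge g, ?_, ?_, ?_⟩
  · rw [S.bridge_zero]
    exact hx g
  · rw [S.bridge_time]
    exact hy g
  · exact S.setLIntegral_bridge_le hρ (c := fun g => (N ^ p * g.mass / m) ^ (1 / Q))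
      (fun g => Real.rpow_nonneg (hpos g).le _) (fun g => (hf'cost g ρ).trans (hcost g))
      (fun g => hdecay g _ (hlmass g)) (fun g => hdecay g _ (hrmass g)) g

/-! ### Modulus bounds for continua -/

lemma setDist_le_dist {E F : Set Z} {a b : Z} (ha : a ∈ E) (hb : b ∈ F) :
    setDist E F ≤ dist a b := by
  refine csInf_le ⟨0, ?_⟩ ⟨a, ha, b, hb, rfl⟩
  rintro _ ⟨x, -, y, -, rfl⟩
  exact dist_nonneg

lemma exists_lt_dist_of_lt_diam {E : Set Z} {δ : ℝ} (hδ : 0 ≤ δ) (hE : 2 * δ < Metric.diam E)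
    (c : Z) : ∃ z ∈ E, δ < dist z c := by
  by_contra! hcon
  exact absurd (Metric.diam_le_of_subset_closedBall (x := c) hδ fun z hz => hcon z hz)
    (not_le.2 hE)

/-- Balls of a fixed relative distance are joined by cheap curves if short paths between them have
large modulus. -/
lemma hasCheapCurves_withDensity [MeasurableSpace Z] [BorelSpace Z] {μ : Measure Z} {Q C m L : ℝ}
    (hQ : 1 ≤ Q) (hm : 0 < m) (hL : 0 < L)
    (hmod : ∀ (R : ℝ) (a a' : Z), 0 < R →
      setDist (Metric.ball a R) (Metric.ball a' R) ≤ C * R →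
      ENNReal.ofReal m < modulus μ Q {γ ∈ connectingPaths (Metric.ball a R) (Metric.ball a' R) |
        pathLength γ ≤ ENNReal.ofReal (L * R)})
    {ρ : Z → ℝ≥0∞} (hρ : Measurable ρ) :
    HasCheapCurves (μ.withDensity fun z => ρ z ^ Q) ρ Q C m L := by
  intro a b R M hR hM hab hmass
  rw [withDensity_apply _ Metric.isOpen_ball.measurableSet] at hmass
  refine exists_curve_of_lt_modulus hQ hm hL hR hM (hmod R a b hR ?_) hρ hmass
  exact (setDist_le_dist (Metric.mem_ball_self hR) (Metric.mem_ball_self hR)).trans hab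

/-- Two continua contain points at controlled distance from each other. -/
lemma exists_dist_mem_of_relDist_le {E F : Set Z} (hE : IsContinuum E) (hF : IsContinuum F) {t : ℝ}
    (ht : relDist E F ≤ t) :
    ∃ s > 0, ∃ a ∈ E, ∃ b ∈ F, 4 * s ≤ dist a b ∧ dist a b ≤ 32 * (t + 2) * s ∧
      (∃ z ∈ E, s ≤ dist z a) ∧ ∃ z ∈ F, s ≤ dist z b := by
  set δ := min (Metric.diam E) (Metric.diam F) with hδdef
  have hδ : 0 < δ := lt_min (Metric.diam_pos hE.2.2 hE.1.isBounded)
    (Metric.diam_pos hF.2.2 hF.1.isBounded)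
  have hδE : δ ≤ Metric.diam E := min_le_left _ _
  have hδF : δ ≤ Metric.diam F := min_le_right _ _
  have hdist : setDist E F ≤ t * δ := (div_le_iff₀ hδ).1 ht
  have hne : (image2 dist E F).Nonempty := hE.2.1.nonempty.image2 hF.2.1.nonempty
  obtain ⟨_, ⟨a₀, ha₀, b, hb, rfl⟩, hab⟩ :=
    exists_lt_of_csInf_lt hne (lt_add_of_pos_right (setDist E F) hδ)
  have hfarE : ∀ c, ∃ z ∈ E, δ / 4 ≤ dist z c := fun c => by
    obtain ⟨z, hz, h⟩ := exists_lt_dist_of_lt_diam (E := E) (δ := δ / 4)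
      (by positivity) (by linarith) c
    exact ⟨z, hz, h.le⟩
  have hfarF : ∀ c, ∃ z ∈ F, δ / 4 ≤ dist z c := fun c => by
    obtain ⟨z, hz, h⟩ := exists_lt_dist_of_lt_diam (E := F) (δ := δ / 4)
      (by positivity) (by linarith) c
    exact ⟨z, hz, h.le⟩
  have hsmall : δ / 32 ≤ δ / 4 := by linarith
  -- If the nearly closest points are too close, `a₀` is moved within `E` by `δ / 4`. Separation by
  -- four radii keeps the curve between the balls from being too small.
  have hex : ∃ a ∈ E, 4 * (δ / 32) ≤ dist a b ∧ dist a b ≤ 32 * (t + 2) * (δ / 32) := by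
    by_cases h : 4 * (δ / 32) ≤ dist a₀ b
    · exact ⟨a₀, ha₀, h, by linarith⟩
    · obtain ⟨z, hz, hza⟩ := hfarE a₀
      obtain ⟨a, ha, haa⟩ := exists_dist_eq hE.2.1.isPreconnected ha₀ hz
        (by positivity : 0 ≤ δ / 4) hza
      have h1 := dist_triangle a a₀ b
      have h2 := dist_triangle_right a a₀ b
      exact ⟨a, ha, by linarith, by linarith⟩
  obtain ⟨a, ha, h1, h2⟩ := hex
  obtain ⟨z, hz, hza⟩ := hfarE a
  obtain ⟨w, hw, hwb⟩ := hfarF b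
  exact ⟨δ / 32, by positivity, a, ha, b, hb, h1, h2, ⟨z, hz, hsmall.trans hza⟩,
    ⟨w, hw, hsmall.trans hwb⟩⟩

/-- Two continua are joined by a curve of small cost. -/
lemma exists_curve_between_continua [CompleteSpace Z] [MeasurableSpace Z] [BorelSpace Z]
    {ν : Measure Z} {ρ : Z → ℝ≥0∞} (hρ : Measurable ρ) {Q m L κ m₀ L₀ t M : ℝ} {N p : ℕ}
    (hQ : 1 ≤ Q) (hm : 0 < m) (hL : 0 < L) (hN : 0 < N) (hNQ : (4 : ℝ) ^ Q ≤ N)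
    (hκ : κ = 1 / (12 * N)) (hp : L + 2 ≤ (κ ^ p)⁻¹)
    (hcurve : HasCheapCurves ν ρ Q (3 / κ) m L) (hm₀ : 0 < m₀)
    (hcurve₀ : HasCheapCurves ν ρ Q (32 * (t + 2)) m₀ L₀) (hM : 0 < M)
    (hν : ν univ ≤ ENNReal.ofReal M) {E F : Set Z} (hE : IsContinuum E) (hF : IsContinuum F)
    (ht : relDist E F ≤ t) :
    ∃ (T : ℝ) (h : ℝ → Z), 0 ≤ T ∧ CoarseLipschitz 0 h ∧ h 0 ∈ E ∧ h T ∈ F ∧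
      ∫⁻ t in Icc 0 T, ρ (h t) ≤
        ENNReal.ofReal ((M / m₀) ^ (1 / Q) + 4 * (N ^ p * M / m) ^ (1 / Q)) := by
  obtain ⟨s, hs, a, ha, b, hb, hab, hab', hfarE, hfarF⟩ := exists_dist_mem_of_relDist_le hE hF ht
  have hN' : (1 : ℝ) ≤ N := by exact_mod_cast hN
  have hmeas : ∀ (S : Set Z), ν S ≤ ENNReal.ofReal M := fun S =>
    (measure_mono (subset_univ S)).trans hν
  -- At the initial scale the total mass bounds every ball.
  have hmeas' : ∀ (c : Z) (j : ℕ), ν (Metric.ball c (((κ ^ j)⁻¹ + 4) * s)) ≤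
      ENNReal.ofReal (N ^ j * M) := fun c j =>
    (hmeas _).trans (ENNReal.ofReal_le_ofReal (le_mul_of_one_le_left hM.le (one_le_pow₀ hN')))
  obtain ⟨ℓ, f, hℓ0, -, hf, hf0, hf1, hcost⟩ := hcurve₀ a b s M hs hM hab' (hmeas _)
  rw [Metric.mem_ball] at hf0 hf1
  have hf01 : s ≤ dist (f ℓ) (f 0) := by
    have h1 := dist_triangle4 a (f 0) (f ℓ) b
    rw [dist_comm a (f 0), dist_comm (f 0) (f ℓ)] at h1
    linarith
  have h0mem : f 0 ∈ f '' Icc 0 ℓ := ⟨0, left_mem_Icc.2 hℓ0, rfl⟩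
  have h1mem : f ℓ ∈ f '' Icc 0 ℓ := ⟨ℓ, right_mem_Icc.2 hℓ0, rfl⟩
  let g₁ : Gap ν N κ := ⟨E, f '' Icc 0 ℓ, a, f 0, s, M, hE.1.isClosed,
    (isCompact_image_curve hf ℓ).isClosed, hE.2.1.isPreconnected, isPreconnected_image_curve hf ℓ,
    ha, h0mem, hs, hM, hfarE, ⟨f ℓ, h1mem, hf01⟩, by rw [dist_comm]; exact hf0.le, hmeas' a⟩
  let g₂ : Gap ν N κ := ⟨f '' Icc 0 ℓ, F, f ℓ, b, s, M, (isCompact_image_curve hf ℓ).isClosed,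
    hF.1.isClosed, isPreconnected_image_curve hf ℓ, hF.2.1.isPreconnected,
    h1mem, hb, hs, hM, ⟨f 0, h0mem, by rwa [dist_comm]⟩, hfarF, hf1.le, hmeas' _⟩
  obtain ⟨T₁, h₁, hT₁, hh₁, hE₁, ⟨u, hu, hfu⟩, hcost₁⟩ :=
    g₁.exists_bridge hρ hQ hm hL hN hNQ hκ hp hcurve
  obtain ⟨T₂, h₂, hT₂, hh₂, ⟨w, hw, hfw⟩, hF₂, hcost₂⟩ :=
    g₂.exists_bridge hρ hQ hm hL hN hNQ hκ hp hcurve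
  obtain ⟨d, f', hd0, -, hf', hf'0, hf'1, hf'cost⟩ := exists_subcurve hf hu hw
  have e1 : f' d = h₂ 0 := by rw [hf'1, hfw]
  have e2 : h₁ T₁ = glue d f' h₂ 0 := by rw [glue_of_le hd0, hf'0, hfu]
  refine ⟨T₁ + (d + T₂), glue T₁ h₁ (glue d f' h₂), by positivity, ?_, ?_, ?_, ?_⟩
  · have h3 := hh₁.glue (hf'.glue hh₂ le_rfl le_rfl e1) le_rfl (by simp) e2
    simpa using h3
  · rwa [glue_of_le hT₁]
  · rwa [glue_of_ge e2 (by linarith), add_sub_cancel_left, glue_of_ge e1 (by linarith),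
      add_sub_cancel_left]
  · refine (setLIntegral_glue_le ρ e2).trans ((add_le_add hcost₁ ((setLIntegral_glue_le ρ e1).trans
      (add_le_add ((hf'cost ρ).trans hcost) hcost₂))).trans ?_)
    have n1 : 0 ≤ (M / m₀) ^ (1 / Q) := by positivity
    have n2 : 0 ≤ (N ^ p * M / m) ^ (1 / Q) := by positivity
    change ENNReal.ofReal (2 * (N ^ p * M / m) ^ (1 / Q)) + (ENNReal.ofReal ((M / m₀) ^ (1 / Q)) +
      ENNReal.ofReal (2 * (N ^ p * M / m) ^ (1 / Q))) ≤ _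
    rw [← ENNReal.ofReal_add (by positivity) (by positivity),
      ← ENNReal.ofReal_add (by positivity) (by positivity)]
    exact ENNReal.ofReal_le_ofReal (by linarith)

lemma rpow_one_div_le_of_le {x y Q : ℝ} (hQ : 0 < Q) (hx : 0 ≤ x) (hy : 0 ≤ y) (h : x ≤ y ^ Q) :
    x ^ (1 / Q) ≤ y :=
  calc x ^ (1 / Q) ≤ (y ^ Q) ^ (1 / Q) := Real.rpow_le_rpow hx h (by positivity)
    _ = y := by rw [← Real.rpow_mul hy, mul_one_div_cancel hQ.ne', Real.rpow_one]

/-- The modulus of the paths joining two continua is bounded below in terms of an upper bound for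
their relative distance. -/
lemma exists_le_modulus_of_relDist_le [CompleteSpace Z] [MeasurableSpace Z] [BorelSpace Z]
    {μ : Measure Z} {Q : ℝ} (hQ : 1 ≤ Q)
    (hball : ∀ C : ℝ, 0 < C → ∃ m L : ℝ, 0 < m ∧ 0 < L ∧
      ∀ (R : ℝ) (a a' : Z), 0 < R →
        setDist (Metric.ball a R) (Metric.ball a' R) ≤ C * R →
        ENNReal.ofReal m < modulus μ Q {γ ∈ connectingPaths (Metric.ball a R) (Metric.ball a' R) |
          pathLength γ ≤ ENNReal.ofReal (L * R)}) {t : ℝ} (ht : 0 ≤ t) :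
    ∃ ψ : ℝ, 0 < ψ ∧ ∀ E F : Set Z, IsContinuum E → IsContinuum F → relDist E F ≤ t →
      ENNReal.ofReal ψ ≤ modulus μ Q (connectingPaths E F) := by
  have hQ0 : 0 < Q := by linarith
  obtain ⟨N, hNQ⟩ := exists_nat_ge ((4 : ℝ) ^ Q)
  have hN : 0 < N := by
    have h1 : (0 : ℝ) < N := (Real.rpow_pos_of_pos (by norm_num) Q).trans_le hNQ
    exact_mod_cast h1
  have hN' : (1 : ℝ) ≤ N := by exact_mod_cast hN
  obtain ⟨κ, hκ⟩ : ∃ κ : ℝ, κ = 1 / (12 * N) := ⟨_, rfl⟩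
  have hκ0 : 0 < κ := by rw [hκ]; positivity
  obtain ⟨m, L, hm, hL, hmod⟩ := hball (3 / κ) (by positivity)
  obtain ⟨m₀, L₀, hm₀, hL₀, hmod₀⟩ := hball (32 * (t + 2)) (by positivity)
  obtain ⟨p, hp⟩ : ∃ p : ℕ, L + 2 ≤ (κ ^ p)⁻¹ := by
    have h1 : 1 < κ⁻¹ := by
      rw [hκ, one_div, inv_inv]
      linarith
    obtain ⟨p, hp⟩ := pow_unbounded_of_one_lt (L + 2) h1
    exact ⟨p, by rw [← inv_pow]; exact hp.le⟩
  -- Makes the total cost at most `1 / 4 + 4 * (1 / 8) < 1`.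
  set ψ := min (m₀ * (1 / 4) ^ Q) (m / N ^ p * (1 / 8) ^ Q) with hψ
  have hψ0 : 0 < ψ := by
    rw [hψ]
    positivity
  refine ⟨ψ, hψ0, fun E F hE hF hEF => ?_⟩
  by_contra! hlt
  rw [modulus] at hlt
  simp only [iInf_lt_iff] at hlt
  obtain ⟨ρ, ⟨hρ, hadm⟩, hint⟩ := hlt
  obtain ⟨T, h, hT, hh, h0, h1, hcost⟩ := exists_curve_between_continua
    (ν := μ.withDensity fun z => ρ z ^ Q) hρ hQ hm hL hN hNQ hκ hp
    (hasCheapCurves_withDensity hQ hm hL hmod hρ) hm₀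
    (hasCheapCurves_withDensity hQ hm₀ hL₀ hmod₀ hρ) hψ0
    (by rw [withDensity_apply _ MeasurableSet.univ, Measure.restrict_univ]; exact hint.le)
    hE hF hEF
  have hle := hadm (rescaledPath hh.lipschitzWith T)
    ⟨by simpa [rescaledPath] using h0, by simpa [rescaledPath] using h1⟩
    (isRectifiable_rescaledPath hh.lipschitzWith hT)
  have hle' := hle.trans ((lineIntegral_rescaledPath_le hh.lipschitzWith hT ρ).trans hcost)
  rw [ENNReal.one_le_ofReal] at hle'
  have c1 : (ψ / m₀) ^ (1 / Q) ≤ 1 / 4 := by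
    refine rpow_one_div_le_of_le hQ0 (by positivity) (by norm_num) ?_
    rw [div_le_iff₀ hm₀, mul_comm]
    exact min_le_left _ _
  have c2 : (N ^ p * ψ / m) ^ (1 / Q) ≤ 1 / 8 := by
    refine rpow_one_div_le_of_le hQ0 (by positivity) (by norm_num) ?_
    have h3 : ψ ≤ m / N ^ p * (1 / 8) ^ Q := min_le_right _ _
    have hNp : (0 : ℝ) < N ^ p := by positivity
    rw [div_le_iff₀ hm]
    calc N ^ p * ψ ≤ N ^ p * (m / N ^ p * (1 / 8) ^ Q) := by gcongr
      _ = (1 / 8) ^ Q * m := by field_simp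
  linarith

/-! ### Connectedness and the Loewner function -/

lemma modulus_empty [MeasurableSpace Z] {μ : Measure Z} {Q : ℝ} (hQ : 0 < Q) :
    modulus μ Q (∅ : Set C(I, Z)) = 0 := by
  refine le_antisymm ((iInf₂_le (fun _ => 0) ⟨measurable_const, by simp⟩).trans ?_) zero_le
  simp [hQ]

/-- Connectedness follows from the existence of paths between balls. -/
lemma preconnectedSpace_of_modulus_ball_pos [MeasurableSpace Z] {μ : Measure Z} {Q : ℝ}
    (hQ : 1 ≤ Q)
    (hball : ∀ C : ℝ, 0 < C → ∃ m L : ℝ, 0 < m ∧ 0 < L ∧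
      ∀ (R : ℝ) (a a' : Z), 0 < R →
        setDist (Metric.ball a R) (Metric.ball a' R) ≤ C * R →
        ENNReal.ofReal m < modulus μ Q {γ ∈ connectingPaths (Metric.ball a R) (Metric.ball a' R) |
          pathLength γ ≤ ENNReal.ofReal (L * R)}) : PreconnectedSpace Z := by
  rw [preconnectedSpace_iff_clopen]
  intro s hs
  by_contra! hcon
  obtain ⟨hne, huniv⟩ := hcon
  obtain ⟨a, ha⟩ := hne
  obtain ⟨b, hb⟩ := (ne_univ_iff_exists_notMem s).1 huniv
  obtain ⟨r₁, hr₁, h₁⟩ := Metric.isOpen_iff.1 hs.isOpen a ha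
  obtain ⟨r₂, hr₂, h₂⟩ := Metric.isOpen_iff.1 hs.compl.isOpen b hb
  have hR : 0 < min r₁ r₂ := lt_min hr₁ hr₂
  obtain ⟨m, L, hm, hL, hmod⟩ := hball ((dist a b + 1) / min r₁ r₂) (by positivity)
  have hlt := hmod (min r₁ r₂) a b hR (by
    rw [div_mul_cancel₀ _ hR.ne']
    exact (setDist_le_dist (Metric.mem_ball_self hR) (Metric.mem_ball_self hR)).trans
      (by linarith))
  -- No path leads from a clopen set to its complement, so the family would have modulus zero.
  have hempty : {γ ∈ connectingPaths (Metric.ball a (min r₁ r₂)) (Metric.ball b (min r₁ r₂)) |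
      pathLength γ ≤ ENNReal.ofReal (L * min r₁ r₂)} = ∅ := by
    refine eq_empty_of_forall_notMem fun γ hγ => ?_
    have h0 : γ 0 ∈ s := h₁ (Metric.ball_subset_ball (min_le_left _ _) hγ.1.1)
    have h1 : γ 1 ∈ sᶜ := h₂ (Metric.ball_subset_ball (min_le_right _ _) hγ.1.2)
    rcases isClopen_iff.1 (hs.preimage γ.continuous) with h | h
    · exact absurd (show (0 : I) ∈ γ ⁻¹' s from h0) (by simp [h])
    · exact h1 (show (1 : I) ∈ γ ⁻¹' s by simp [h])
  rw [hempty, modulus_empty (by linarith)] at hlt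
  exact absurd hlt not_lt_zero

/-- A function on the natural numbers with positive values has a positive antitone minorant on the
real line. -/
lemma exists_antitone_minorant {ψ : ℕ → ℝ} (hψ : ∀ n, 0 < ψ n) :
    ∃ Ψ : ℝ → ℝ, (∀ t, 0 < Ψ t) ∧ Antitone Ψ ∧ ∀ t, Ψ t ≤ ψ ⌈t⌉₊ := by
  refine ⟨fun t => (Finset.range (⌈t⌉₊ + 1)).inf' Finset.nonempty_range_add_one ψ,
    fun t => ?_, fun s t hst => ?_, fun t => ?_⟩
  · rw [Finset.lt_inf'_iff]
    exact fun i _ => hψ i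
  · refine Finset.inf'_mono _ ?_ _
    exact Finset.range_mono (by have := Nat.ceil_mono hst; omega)
  · exact Finset.inf'_le _ (by simp)

end BallLoewner

end

theorem proposition3p1 {Z : Type*} [MetricSpace Z] [CompleteSpace Z] [LocallyCompactSpace Z]
    [Nonempty Z] [MeasurableSpace Z] [BorelSpace Z]
    (μ : MeasureTheory.Measure Z) [MeasureTheory.IsLocallyFiniteMeasure μ] [μ.IsOpenPosMeasure]
    (Q : ℝ) (hQ : 1 ≤ Q)
    (hball : ∀ C : ℝ, 0 < C → ∃ m L : ℝ, 0 < m ∧ 0 < L ∧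
      ∀ (R : ℝ) (a a' : Z), 0 < R →
        BallLoewner.setDist (Metric.ball a R) (Metric.ball a' R) ≤ C * R →
        ENNReal.ofReal m < BallLoewner.modulus μ Q
          {γ ∈ BallLoewner.connectingPaths (Metric.ball a R) (Metric.ball a' R) |
            BallLoewner.pathLength γ ≤ ENNReal.ofReal (L * R)}) :
    BallLoewner.IsLoewner μ Q := by
  have := BallLoewner.preconnectedSpace_of_modulus_ball_pos hQ hball
  refine ⟨⟨inferInstance⟩, ?_⟩
  -- Bounds at integer values suffice: their running minimum at `⌈t⌉₊` is positive and antitone.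
  choose ψ hψ hmod using fun n : ℕ =>
    BallLoewner.exists_le_modulus_of_relDist_le hQ hball (n.cast_nonneg : (0 : ℝ) ≤ n)
  obtain ⟨Ψ, hΨ, hanti, hle⟩ := BallLoewner.exists_antitone_minorant hψ
  refine ⟨Ψ, fun t _ => hΨ t, hanti.antitoneOn _, fun E F hE hF _ => ?_⟩
  exact (ENNReal.ofReal_le_ofReal (hle _)).trans (hmod _ E F hE hF (Nat.le_ceil _))
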